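/- **Proposition.** Let $p\ge 0$ be an integer, let $q\in\{1,2\}$, and let $\mu$ be a finite Borel measure on $[0,\infty)$ with $\mu((0,\infty))>0$ whose support is bounded and bounded away from zero, i.e. $0<m_\mu\le M_\mu<\infty$ with $m_\mu=\inf\operatorname{supp}(\mu)$ and $M_\mu=\sup\operatorname{supp}(\mu)$. Put $h(z)=\int_0^\infty e^{-tz}\,\mu(dt)$ for $z\ge 0$, and let $\mathcal H$ be the real reproducing kernel Hilbert space of functions on $\mathbb R^p$ with kernel $k(x,x')=h(\|x-x'\|_q^q)$. Let $Q$ be a probability distribution of a pair $(X,Y)\in\mathbb R^p\times\mathbb R$ with $\mathbb E_Q[Y^2]<\infty$. For $\beta\in\mathbb R^p$ with $\beta\ge 0$ (coordinatewise) and $\lambda>0$ define $$F^{\mathrm{KRR}}_\lambda(\beta;Q)=\min_{f\in\mathcal H}\ \tfrac12\,\mathbb E_Q\big[(Y-f(\beta^{1/q}\odot X))^2\big]+\tfrac{\lambda}{2}\|f\|_{\mathcal H}^2,$$ where $\beta^{1/q}\odot X=(\beta_i^{1/q}X_i)_{i\le p}$. Then for every $\beta\ge 0$ this minimum is attained for every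 $\lambda>0$, and $$\lim_{\lambda\to0^+}F^{\mathrm{KRR}}_\lambda(\beta;Q)=\tfrac12\,\mathbb E_Q\big[\operatorname{Var}(Y\mid X_{\operatorname{supp}(\beta)})\big],$$ where $\operatorname{supp}(\beta)=\{i:\beta_i\ne 0\}$ and $X_S=(X_i)_{i\in S}$. -/

import Mathlib

open MeasureTheory ProbabilityTheory Filter Topology
open scoped NNReal

noncomputable section

namespace KernelFeature

/-- The profile `h(z) = ∫ exp(-t z) μ(dt)` attached to a measure `μ` on `ℝ₊`. -/
def profile (μ : Measure ℝ≥0) (z : ℝ) : ℝ := ∫ t, Real.exp (-(t : ℝ) * z) ∂μ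

/-- The measure `μ` charges `(0, ∞)` and its support is bounded and bounded away from zero. Since `sInf ∅ = 0` in `ℝ≥0`, the
condition on the infimum also says that the support is nonempty. -/
structure SupportRegular (μ : Measure ℝ≥0) : Prop where
  pos_mass : 0 < μ (Set.Ioi 0)
  inf_pos : 0 < sInf μ.support
  bddAbove : BddAbove μ.support

/-- The `ℓ_q`-type kernel `k(x, x') = h(‖x - x'‖_q ^ q)` on `ℝ^p`; the scalar `k(x, x')` is
regarded as an operator on `ℝ`, as in `RKHS.kernel`. -/
def lqKernel (μ : Measure ℝ≥0) (q p : ℕ) : Matrix (Fin p → ℝ) (Fin p → ℝ) (ℝ →L[ℝ] ℝ) :=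
  .of fun x x' => profile μ (∑ i, |x i - x' i| ^ q) • ContinuousLinearMap.id ℝ ℝ

theorem posSemidef_integral {n Ω : Type*} [MeasurableSpace Ω] (ν : Measure Ω)
    (K : Ω → Matrix n n ℝ) (hK : ∀ u, (K u).PosSemidef)
    (hint : ∀ i j, Integrable (fun u => K u i j) ν) :
    (Matrix.of fun i j => ∫ u, K u i j ∂ν).PosSemidef := by
  refine ⟨?_, fun x => ?_⟩
  · ext i j
    simp only [Matrix.conjTranspose_apply, Matrix.of_apply, star_trivial]
    congr 1
    ext u
    exact (hK u).1.apply i j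
  · have h : (x.sum fun i xi => x.sum fun j xj => star xi *
        (Matrix.of fun i j => ∫ u, K u i j ∂ν) i j * xj) =
        ∫ u, (x.sum fun i xi => x.sum fun j xj => star xi * K u i j * xj) ∂ν := by
      simp only [Finsupp.sum, Matrix.of_apply]
      rw [integral_finsetSum _ fun i _ => integrable_finsetSum _ fun j _ =>
        ((hint i j).const_mul _).mul_const _]
      refine Finset.sum_congr rfl fun i _ => ?_
      rw [integral_finsetSum _ fun j _ => ((hint i j).const_mul _).mul_const _]
      refine Finset.sum_congr rfl fun j _ => ?_
      rw [integral_mul_const, integral_const_mul]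
    rw [h]
    exact integral_nonneg fun u => (hK u).2 x

theorem posSemidef_rankOne {n : Type*} (f : n → ℝ) :
    (Matrix.of fun i j => f i * f j).PosSemidef := by
  refine ⟨?_, fun x => ?_⟩
  · ext i j
    simp [mul_comm]
  · have h : (x.sum fun i xi => x.sum fun j xj => star xi *
        (Matrix.of fun i j => f i * f j) i j * xj) = (x.sum fun i xi => xi * f i) ^ 2 := by
      simp only [Finsupp.sum, Matrix.of_apply, star_trivial, sq, Finset.sum_mul_sum]
      exact Finset.sum_congr rfl fun i _ => Finset.sum_congr rfl fun j _ => by ring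
    rw [h]
    positivity

theorem posSemidef_exp_abs (s : ℝ) (hs : 0 ≤ s) :
    (Matrix.of fun a b : ℝ => Real.exp (-s * |a - b|)).PosSemidef := by
  have hi : ∀ a b : ℝ, Integrable (fun u =>
      (Real.exp (-s * a) * (Set.Ioc 0 (Real.exp (2 * s * a))).indicator 1 u) *
      (Real.exp (-s * b) * (Set.Ioc 0 (Real.exp (2 * s * b))).indicator (1 : ℝ → ℝ) u)) := by
    intro a b
    have h : Integrable ((Set.Ioc 0 (Real.exp (2 * s * a)) ∩
        Set.Ioc 0 (Real.exp (2 * s * b))).indicator (1 : ℝ → ℝ)) := by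
      rw [integrable_indicator_iff (measurableSet_Ioc.inter measurableSet_Ioc)]
      exact integrableOn_const (by
        rw [Set.Ioc_inter_Ioc]; simp)
    refine (h.const_mul (Real.exp (-s * a) * Real.exp (-s * b))).congr (.of_forall fun u => ?_)
    simp only [Set.inter_indicator_one, Pi.mul_apply]
    ring
  convert! posSemidef_integral (volume : Measure ℝ) (fun u => .of fun a b : ℝ =>
      (Real.exp (-s * a) * (Set.Ioc 0 (Real.exp (2 * s * a))).indicator 1 u) *
      (Real.exp (-s * b) * (Set.Ioc 0 (Real.exp (2 * s * b))).indicator (1 : ℝ → ℝ) u))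
      (fun u => posSemidef_rankOne _) hi using 1
  ext a b
  have h : ∀ u, (Real.exp (-s * a) * (Set.Ioc 0 (Real.exp (2 * s * a))).indicator 1 u) *
      (Real.exp (-s * b) * (Set.Ioc 0 (Real.exp (2 * s * b))).indicator (1 : ℝ → ℝ) u) =
      (Real.exp (-s * a) * Real.exp (-s * b)) * (Set.Ioc 0 (Real.exp (2 * s * a)) ∩
        Set.Ioc 0 (Real.exp (2 * s * b))).indicator (1 : ℝ → ℝ) u := fun u => by
    simp only [Set.inter_indicator_one, Pi.mul_apply]
    ring
  simp only [Matrix.of_apply, h]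
  rw [integral_const_mul, integral_indicator_one (measurableSet_Ioc.inter measurableSet_Ioc),
    Set.Ioc_inter_Ioc, Real.volume_real_Ioc]
  rcases le_total a b with hab | hab
  · have : Real.exp (2 * s * a) ≤ Real.exp (2 * s * b) := Real.exp_le_exp.2 (by nlinarith)
    rw [abs_of_nonpos (by linarith), inf_eq_left.2 this, sup_idem, sub_zero,
      max_eq_left (Real.exp_pos _).le, ← Real.exp_add, ← Real.exp_add]
    ring_nf
  · have : Real.exp (2 * s * b) ≤ Real.exp (2 * s * a) := Real.exp_le_exp.2 (by nlinarith)
    rw [abs_of_nonneg (by linarith), inf_eq_right.2 this, sup_idem, sub_zero,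
      max_eq_left (Real.exp_pos _).le, ← Real.exp_add, ← Real.exp_add]
    ring_nf

theorem posSemidef_exp_sq (s : ℝ) (hs : 0 ≤ s) :
    (Matrix.of fun a b : ℝ => Real.exp (-s * |a - b| ^ 2)).PosSemidef := by
  obtain ⟨v, hv⟩ : ∃ v : ℝ≥0, (v : ℝ) = 2 * s := ⟨⟨2 * s, by positivity⟩, rfl⟩
  have hE : ∀ a b u : ℝ, Real.exp (-2 * s * a ^ 2 + a * u) * Real.exp (-2 * s * b ^ 2 + b * u) =
      Real.exp (-2 * s * a ^ 2 - 2 * s * b ^ 2) * Real.exp ((a + b) * u) := fun a b u => by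
    rw [← Real.exp_add, ← Real.exp_add]
    ring_nf
  have hi : ∀ a b : ℝ, Integrable (fun u =>
      Real.exp (-2 * s * a ^ 2 + a * u) * Real.exp (-2 * s * b ^ 2 + b * u))
      (gaussianReal 0 v) := by
    intro a b
    simp only [hE]
    exact (integrable_exp_mul_gaussianReal _).const_mul _
  convert! posSemidef_integral (gaussianReal 0 v)
      (fun u => .of fun a b : ℝ =>
        Real.exp (-2 * s * a ^ 2 + a * u) * Real.exp (-2 * s * b ^ 2 + b * u))
      (fun u => posSemidef_rankOne _) hi using 1
  ext a b
  have hm := mgf_gaussianReal (p := gaussianReal 0 v) (X := id)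
    Measure.map_id (a + b)
  simp only [mgf, id] at hm
  simp only [Matrix.of_apply, hE]
  rw [integral_const_mul, hm, ← Real.exp_add, sq_abs]
  congr 1
  rw [hv]
  ring

theorem posSemidef_exp_sum (s : ℝ) (hs : 0 ≤ s) (q p : ℕ) (hq : q = 1 ∨ q = 2) :
    (Matrix.of fun x y : Fin p → ℝ => Real.exp (-s * ∑ i, |x i - y i| ^ q)).PosSemidef := by
  have h1 : (Matrix.of fun a b : ℝ => Real.exp (-s * |a - b| ^ q)).PosSemidef := by
    rcases hq with rfl | rfl
    · simpa using posSemidef_exp_abs s hs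
    · exact posSemidef_exp_sq s hs
  have h2 : ∀ T : Finset (Fin p), (Matrix.of fun x y : Fin p → ℝ =>
      Real.exp (-s * ∑ i ∈ T, |x i - y i| ^ q)).PosSemidef := by
    classical
    intro T
    induction T using Finset.induction_on with
    | empty => simpa using posSemidef_rankOne (fun _ : Fin p → ℝ => (1 : ℝ))
    | insert i T hi ih =>
      convert! (h1.submatrix fun x : Fin p → ℝ => x i).hadamard ih using 1
      ext x y
      simp only [Matrix.of_apply, Matrix.hadamard_apply, Matrix.submatrix_apply,
        Finset.sum_insert hi, mul_add, Real.exp_add]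
  exact h2 Finset.univ

/-- The `ℓ_q`-type kernel is positive semidefinite, so that an RKHS with this kernel exists, namely
`RKHS.OfKernel (lqKernel μ q p)`; see `RKHS.OfKernel.kernel_ofKernel`. -/
theorem posSemidef_lqKernel (μ : Measure ℝ≥0) [IsFiniteMeasure μ] (q p : ℕ)
    (hq : q = 1 ∨ q = 2) : (lqKernel μ q p).PosSemidef := by
  have hi : ∀ x y : Fin p → ℝ, Integrable
      (fun t : ℝ≥0 => Real.exp (-(t : ℝ) * ∑ i, |x i - y i| ^ q)) μ := fun x y => by
    refine Integrable.of_bound (C := 1) (by fun_prop) (.of_forall fun t => ?_)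
    rw [Real.norm_eq_abs, abs_of_pos (Real.exp_pos _), Real.exp_le_one_iff, neg_mul,
      neg_nonpos]
    positivity
  have h := posSemidef_integral μ
    (fun t => .of fun x y : Fin p → ℝ => Real.exp (-(t : ℝ) * ∑ i, |x i - y i| ^ q))
    (fun t => posSemidef_exp_sum t t.2 q p hq) hi
  have key := (RKHS.posSemidef_tfae (K := lqKernel μ q p)).out 0 2
  refine key.2 ⟨?_, fun vv => ?_⟩
  · ext x y
    have h1 : ContinuousLinearMap.adjoint (ContinuousLinearMap.id ℝ ℝ) =
        ContinuousLinearMap.id ℝ ℝ := LinearMap.IsSymmetric.isSelfAdjoint fun _ _ => rfl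
    simp [lqKernel, Matrix.conjTranspose_apply, ContinuousLinearMap.star_eq_adjoint,
      abs_sub_comm, h1]
  · convert! h.2 vv using 1
    simp only [Finsupp.sum, lqKernel, profile, Matrix.of_apply, RCLike.re_to_real]
    refine Finset.sum_congr rfl fun x _ => Finset.sum_congr rfl fun y _ => ?_
    simp [abs_sub_comm (y _), mul_comm, mul_left_comm]

/-- The rescaled vector `β^{1/q} ⊙ x`. -/
def rescale {p : ℕ} (q : ℕ) (β x : Fin p → ℝ) : Fin p → ℝ :=
  fun i => β i ^ (1 / (q : ℝ)) * x i

/-- The penalized least squares functional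
`f ↦ ½ E_Q[(Y - f(β^{1/q} ⊙ X))²] + (lam / 2) ‖f‖²` on an RKHS `H` of functions on `ℝ^p`,
where `(X, Y) ∼ Q`. -/
def krrFunctional {p : ℕ} (H : Type*) [NormedAddCommGroup H] [InnerProductSpace ℝ H]
    [RKHS ℝ H (Fin p → ℝ) ℝ] (q : ℕ) (Q : Measure ((Fin p → ℝ) × ℝ)) (β : Fin p → ℝ)
    (lam : ℝ) (f : H) : ℝ :=
  1 / 2 * ∫ z, (z.2 - f (rescale q β z.1)) ^ 2 ∂Q + lam / 2 * ‖f‖ ^ 2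

/-- The kernel ridge regression objective `F^KRR_lam(β; Q)`. -/
def krrObjective {p : ℕ} (H : Type*) [NormedAddCommGroup H] [InnerProductSpace ℝ H]
    [RKHS ℝ H (Fin p → ℝ) ℝ] (q : ℕ) (Q : Measure ((Fin p → ℝ) × ℝ)) (β : Fin p → ℝ)
    (lam : ℝ) : ℝ :=
  ⨅ f : H, krrFunctional H q Q β lam f

/-- The σ-algebra generated by `X_S`, the coordinates of `X` with index in `S`. -/
@[reducible] def sigmaX {p : ℕ} (S : Set (Fin p)) : MeasurableSpace ((Fin p → ℝ) × ℝ) :=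
  MeasurableSpace.comap (fun z (i : S) => z.1 i) inferInstance

end KernelFeature

end

/-!
The minimiser exists because `f ↦ f ∘ Z`, with `Z = β^{1/q} ⊙ X`, is a bounded operator from `H` to
`L²(Q)`, and as the penalty vanishes the penalised risk tends to half the squared distance of `Y` to
the closure of `{f ∘ Z | f ∈ H}`. This closure is all of `L²(σ(Z))`, and `σ(Z)` is generated by the
coordinates of `X` in the support of `β`, so the distance is the expected conditional variance.

Density rests on a spectral representation: `k(x, x') = ∫ exp(i ⟨a, x - x'⟩) ρ(da)`, where `ρ` is
the law, up to mass, of `t^{1/q} U` with `t ∼ μ` and independent coordinates of `U` that are Cauchy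
(`q = 1`) or Gaussian (`q = 2`). As `μ` charges `(0, ∞)`, the measure `ρ` has full support. If `g`
is orthogonal to all `k(x, Z)`, then `φ(a) = E[g exp(i ⟨a, Z⟩)]` satisfies `∫ |φ|² dρ = 0`; being
continuous, `φ` vanishes identically, which means `E[g | Z] = 0`.
-/

noncomputable section

namespace KernelFeature

open scoped InnerProductSpace ComplexConjugate

section Tikhonov

variable {E H : Type*} [NormedAddCommGroup E] [InnerProductSpace ℝ E]
  [NormedAddCommGroup H] [InnerProductSpace ℝ H]

/-- The Tikhonov functional: least squares for the equation `T f = y`, penalised by the squared norm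
of `f` with weight `lam`. -/
def tikhonov (T : H →L[ℝ] E) (y : E) (lam : ℝ) (f : H) : ℝ :=
  1 / 2 * ‖y - T f‖ ^ 2 + lam / 2 * ‖f‖ ^ 2

theorem tikhonov_add (T : H →L[ℝ] E) (y : E) (lam : ℝ) (f g : H) :
    tikhonov T y lam (f + g) =
      tikhonov T y lam f + (⟪T f, T g⟫_ℝ + lam * ⟪f, g⟫_ℝ - ⟪y, T g⟫_ℝ) +
        (1 / 2 * ‖T g‖ ^ 2 + lam / 2 * ‖g‖ ^ 2) := by
  have hsub : y - T (f + g) = (y - T f) - T g := by rw [map_add]; abel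
  rw [tikhonov, tikhonov, hsub, norm_sub_sq_real (y - T f), norm_add_sq_real, inner_sub_left]
  ring

theorem exists_normal_equation [CompleteSpace E] [CompleteSpace H] (T : H →L[ℝ] E) (y : E)
    {lam : ℝ} (hlam : 0 < lam) :
    ∃ f : H, ∀ g, ⟪T f, T g⟫_ℝ + lam * ⟪f, g⟫_ℝ = ⟪y, T g⟫_ℝ := by
  let B : H →L[ℝ] H →L[ℝ] ℝ :=
    (innerSL ℝ).comp (T.adjoint.comp T + lam • ContinuousLinearMap.id ℝ H)
  have hB (f g : H) : B f g = ⟪T f, T g⟫_ℝ + lam * ⟪f, g⟫_ℝ := by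
    change ⟪T.adjoint (T f) + lam • f, g⟫_ℝ = _
    rw [inner_add_left, real_inner_smul_left, ContinuousLinearMap.adjoint_inner_left]
  have hcoercive : IsCoercive B := ⟨lam, hlam, fun u => by
    rw [hB, real_inner_self_eq_norm_sq, real_inner_self_eq_norm_sq]
    nlinarith [sq_nonneg ‖T u‖]⟩
  obtain ⟨f, hf⟩ := hcoercive.continuousLinearEquivOfBilin.surjective (T.adjoint y)
  refine ⟨f, fun g => ?_⟩
  rw [← hB, ← hcoercive.continuousLinearEquivOfBilin_apply, hf,
    ContinuousLinearMap.adjoint_inner_left]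

theorem isLeast_iInf_tikhonov [CompleteSpace E] [CompleteSpace H] (T : H →L[ℝ] E) (y : E)
    {lam : ℝ} (hlam : 0 < lam) :
    IsLeast (Set.range (tikhonov T y lam)) (⨅ f, tikhonov T y lam f) := by
  obtain ⟨f, hf⟩ := exists_normal_equation T y hlam
  have hleast : IsLeast (Set.range (tikhonov T y lam)) (tikhonov T y lam f) := by
    refine ⟨⟨f, rfl⟩, Set.forall_mem_range.2 fun f' => ?_⟩
    rw [← add_sub_cancel f f', tikhonov_add, hf, sub_self, add_zero]
    exact le_add_of_nonneg_right (by positivity)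
  rwa [iInf, hleast.csInf_eq]

theorem tendsto_iInf_add_mul {ι : Type*} {R N : ι → ℝ} (hN : ∀ i, 0 ≤ N i) {c : ℝ}
    (hc : IsGLB (Set.range R) c) :
    Tendsto (fun lam : ℝ => ⨅ i, (R i + lam * N i)) (𝓝[>] 0) (𝓝 c) := by
  have : Nonempty ι := Set.range_nonempty_iff_nonempty.1 hc.nonempty
  have hlower {lam : ℝ} (hlam : 0 < lam) (i : ι) : c ≤ R i + lam * N i :=
    (hc.1 ⟨i, rfl⟩).trans (le_add_of_nonneg_right (mul_nonneg hlam.le (hN i)))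
  refine tendsto_order.2 ⟨fun a ha => ?_, fun a ha => ?_⟩
  · filter_upwards [self_mem_nhdsWithin] with lam hlam
    exact ha.trans_le (le_ciInf (hlower hlam))
  · obtain ⟨_, ⟨i, rfl⟩, -, hi⟩ := hc.exists_between ha
    have hlim : Tendsto (fun lam : ℝ => R i + lam * N i) (𝓝[>] 0) (𝓝 (R i)) :=
      (Continuous.tendsto' (by fun_prop) 0 (R i) (by simp)).mono_left nhdsWithin_le_nhds
    filter_upwards [self_mem_nhdsWithin, hlim.eventually_lt_const hi] with lam hlam hlt
    exact (ciInf_le ⟨c, Set.forall_mem_range.2 (hlower hlam)⟩ i).trans_lt hlt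

theorem isGLB_norm_sub_sq (T : H →L[ℝ] E) (y : E)
    [(T : H →ₗ[ℝ] E).range.topologicalClosure.HasOrthogonalProjection] :
    IsGLB (Set.range fun f => 1 / 2 * ‖y - T f‖ ^ 2)
      (1 / 2 * ‖y - (T : H →ₗ[ℝ] E).range.topologicalClosure.starProjection y‖ ^ 2) := by
  set K := (T : H →ₗ[ℝ] E).range.topologicalClosure
  have hTK (f : H) : T f ∈ K := Submodule.le_topologicalClosure _ ⟨f, rfl⟩
  refine ⟨Set.forall_mem_range.2 fun f => ?_, fun b hb => ?_⟩
  · have hle : ‖y - K.starProjection y‖ ≤ ‖y - T f‖ := by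
      rw [K.starProjection_minimal]
      exact ciInf_le ⟨0, Set.forall_mem_range.2 fun _ => norm_nonneg _⟩ (⟨T f, hTK f⟩ : K)
    gcongr
  · have hclosed : IsClosed {v : E | b ≤ 1 / 2 * ‖y - v‖ ^ 2} :=
      isClosed_le continuous_const (by fun_prop)
    exact closure_minimal (s := Set.range T) (Set.range_subset_iff.2 fun f => hb ⟨f, rfl⟩) hclosed
      (K.starProjection_apply_mem y)

theorem tendsto_iInf_tikhonov (T : H →L[ℝ] E) (y : E)
    [(T : H →ₗ[ℝ] E).range.topologicalClosure.HasOrthogonalProjection] :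
    Tendsto (fun lam => ⨅ f, tikhonov T y lam f) (𝓝[>] 0)
      (𝓝 (1 / 2 * ‖y - (T : H →ₗ[ℝ] E).range.topologicalClosure.starProjection y‖ ^ 2)) := by
  have hlim := tendsto_iInf_add_mul (fun f : H => by positivity : ∀ f : H, 0 ≤ ‖f‖ ^ 2 / 2)
    (isGLB_norm_sub_sq T y)
  simpa only [tikhonov, div_mul_eq_mul_div, mul_div_assoc] using hlim

end Tikhonov

section Composition

/-- The kernel of the RKHS `H` has measurable sections and is bounded on the diagonal, so that every
element of `H` is a bounded measurable function. -/
structure BoundedMeasurableKernel (X : Type*) [MeasurableSpace X] (H : Type*)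
    [NormedAddCommGroup H] [InnerProductSpace ℝ H] [CompleteSpace H] [RKHS ℝ H X ℝ] : Prop where
  measurable_kerFun : ∀ (x : X) (v : ℝ), Measurable (RKHS.kerFun H x v)
  bddAbove_kernel : BddAbove (Set.range fun x : X => ‖RKHS.kernel H x x‖)

variable {X Ω : Type*} [MeasurableSpace X] [MeasurableSpace Ω] {H : Type*} [NormedAddCommGroup H]
  [InnerProductSpace ℝ H] [CompleteSpace H] [RKHS ℝ H X ℝ]

namespace BoundedMeasurableKernel

theorem measurable_coe (hk : BoundedMeasurableKernel X H) (f : H) : Measurable f := by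
  let M : Submodule ℝ H :=
    { carrier := {f | Measurable f}
      add_mem' := fun {f g} (hf : Measurable f) (hg : Measurable g) => by
        simpa only [Set.mem_ofPred_eq, RKHS.coe_add] using hf.add hg
      zero_mem' := by simpa only [Set.mem_ofPred_eq, RKHS.coe_zero] using measurable_zero
      smul_mem' := fun c f (hf : Measurable f) => by
        simpa only [Set.mem_ofPred_eq, RKHS.coe_smul] using hf.const_smul c }
  have hclosed : IsClosed (M : Set H) := IsSeqClosed.isClosed fun u f hu hf =>
    measurable_of_tendsto_metrizable (f := fun n => ⇑(u n)) hu
      (tendsto_pi_nhds.2 fun x => ((RKHS.continuous_eval x).tendsto f).comp hf)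
  have hspan : (Submodule.span ℝ {RKHS.kerFun H x v | (x) (v)}).topologicalClosure ≤ M := by
    refine Submodule.topologicalClosure_minimal _ (Submodule.span_le.2 ?_) hclosed
    rintro _ ⟨x, v, rfl⟩
    exact hk.measurable_kerFun x v
  rw [RKHS.kerFun_dense] at hspan
  exact hspan trivial

theorem exists_norm_apply_le (hk : BoundedMeasurableKernel X H) :
    ∃ C : ℝ, 0 ≤ C ∧ ∀ (f : H) (x : X), ‖f x‖ ≤ C * ‖f‖ := by
  obtain ⟨C, hC⟩ := hk.bddAbove_kernel
  refine ⟨√C, C.sqrt_nonneg, fun f x => (RKHS.norm_apply_le f x).trans ?_⟩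
  rw [mul_comm]
  gcongr
  exact hC ⟨x, rfl⟩

variable {Z : Ω → X} (Q : Measure Ω) [IsFiniteMeasure Q]

theorem memLp_comp (hk : BoundedMeasurableKernel X H) (hZ : Measurable Z) (f : H) :
    MemLp (f ∘ Z) 2 Q := by
  obtain ⟨C, -, hC⟩ := hk.exists_norm_apply_le
  exact .of_bound ((hk.measurable_coe f).comp hZ).aestronglyMeasurable _
    (.of_forall fun ω => hC f (Z ω))

/-- The operator `f ↦ f ∘ Z` from an RKHS to `L²`. -/
def compLp (hk : BoundedMeasurableKernel X H) (hZ : Measurable Z) : H →L[ℝ] Lp ℝ 2 Q :=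
  LinearMap.mkContinuousOfExistsBound
    { toFun := fun f => (hk.memLp_comp Q hZ f).toLp
      map_add' := fun f g => by
        rw [← MemLp.toLp_add]
        exact MemLp.toLp_congr _ _ (.of_forall fun ω => by simp)
      map_smul' := fun c f => by
        rw [RingHom.id_apply, ← MemLp.toLp_const_smul]
        exact MemLp.toLp_congr _ _ (.of_forall fun ω => by simp) }
    (by
      obtain ⟨C, hC₀, hC⟩ := hk.exists_norm_apply_le
      refine ⟨measureUnivNNReal Q ^ (2 : ENNReal).toReal⁻¹ * C, fun f => ?_⟩
      rw [mul_assoc]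
      refine Lp.norm_le_of_ae_bound (by positivity) ?_
      filter_upwards [(hk.memLp_comp Q hZ f).coeFn_toLp] with ω hω
      exact (congrArg norm hω).trans_le (hC f (Z ω)))

theorem compLp_apply (hk : BoundedMeasurableKernel X H) (hZ : Measurable Z) (f : H) :
    hk.compLp Q hZ f = (hk.memLp_comp Q hZ f).toLp :=
  rfl

end BoundedMeasurableKernel

end Composition

section WeightedCharFun

variable {Ω E : Type*} [MeasurableSpace Ω] [MeasurableSpace E] {Q : Measure Ω} {Z : Ω → E}

/-- The image under `Z` of the measure with density the positive part of `g`. -/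
def mapPosPart (Q : Measure Ω) (g : Ω → ℝ) (Z : Ω → E) : Measure E :=
  (Q.withDensity fun ω => ENNReal.ofReal (g ω)).map Z

theorem isFiniteMeasure_mapPosPart {g : Ω → ℝ} (hg : Integrable g Q) :
    IsFiniteMeasure (mapPosPart Q g Z) :=
  have := isFiniteMeasure_withDensity_ofReal hg.2
  inferInstanceAs (IsFiniteMeasure (Measure.map _ _))

variable [NormedAddCommGroup E] [InnerProductSpace ℝ E] [BorelSpace E] [SecondCountableTopology E]

/-- The characteristic function of the image under `Z` of the complex measure with density `g` with
respect to `Q`. -/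
def weightedCharFun (Q : Measure Ω) (g : Ω → ℂ) (Z : Ω → E) (a : E) : ℂ :=
  ∫ ω, g ω * Complex.exp (⟪Z ω, a⟫_ℝ * Complex.I) ∂Q

theorem integrable_mul_cexp_ofReal_mul_I {g : Ω → ℂ} (hg : Integrable g Q) {φ : Ω → ℝ}
    (hφ : AEMeasurable φ Q) :
    Integrable (fun ω => g ω * Complex.exp (φ ω * Complex.I)) Q :=
  hg.mul_bdd (c := 1) (by fun_prop) (.of_forall fun ω => by rw [Complex.norm_exp_ofReal_mul_I])

theorem integrable_ofReal_mul_cexp_ofReal_mul_I {f : Ω → ℝ} (hf : Integrable f Q) {φ : Ω → ℝ}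
    (hφ : AEMeasurable φ Q) :
    Integrable (fun ω => (f ω : ℂ) * Complex.exp (φ ω * Complex.I)) Q :=
  integrable_mul_cexp_ofReal_mul_I hf.ofReal hφ

theorem continuous_weightedCharFun {g : Ω → ℂ} (hg : Integrable g Q) (hZ : Measurable Z) :
    Continuous (weightedCharFun Q g Z) :=
  continuous_of_dominated (bound := fun ω => ‖g ω‖)
    (fun a => (integrable_mul_cexp_ofReal_mul_I hg (by fun_prop)).aestronglyMeasurable)
    (fun a => .of_forall fun ω => by rw [norm_mul, Complex.norm_exp_ofReal_mul_I, mul_one])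
    hg.norm (.of_forall fun ω => by fun_prop)

theorem integral_mul_weightedCharFun [SFinite Q] {ρ : Measure E} [SFinite ρ] {f : Ω → ℂ}
    (hf : Integrable f Q) {ψ : E → ℂ} (hψ : Integrable ψ ρ) (hZ : Measurable Z) :
    ∫ ω, f ω * weightedCharFun ρ ψ id (Z ω) ∂Q = ∫ a, ψ a * weightedCharFun Q f Z a ∂ρ := by
  simp only [weightedCharFun, ← integral_const_mul]
  rw [integral_integral_swap]
  · simp only [id_eq, real_inner_comm, mul_left_comm]
  · have hprod := integrable_mul_cexp_ofReal_mul_I (hf.mul_prod hψ)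
      (φ := fun ωa => ⟪ωa.2, Z ωa.1⟫_ℝ) (by fun_prop)
    simpa only [Function.uncurry_def, id_eq, mul_assoc] using hprod

theorem integral_mul_charFun_sub [SFinite Q] {ρ : Measure E} [IsFiniteMeasure ρ] {g : Ω → ℂ}
    (hg : Integrable g Q) (hZ : Measurable Z) (x : E) :
    ∫ ω, g ω * charFun ρ (Z ω - x) ∂Q =
      ∫ a, Complex.exp (-⟪a, x⟫_ℝ * Complex.I) * weightedCharFun Q g Z a ∂ρ := by
  have hψ := integrable_mul_cexp_ofReal_mul_I (Q := ρ) (integrable_const 1)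
    (φ := fun a => -⟪a, x⟫_ℝ) (by fun_prop)
  simp only [one_mul, Complex.ofReal_neg] at hψ
  rw [← integral_mul_weightedCharFun hg hψ hZ]
  simp only [weightedCharFun, charFun_apply, id_eq, ← Complex.exp_add, inner_sub_right,
    Complex.ofReal_sub, ← add_mul, neg_add_eq_sub]

theorem weightedCharFun_eq_zero_of_integral_mul_charFun_sub [IsFiniteMeasure Q] {ρ : Measure E}
    [IsFiniteMeasure ρ] [ρ.IsOpenPosMeasure] {g : Ω → ℂ} (hg : Integrable g Q) (hZ : Measurable Z)
    (h0 : ∀ x, ∫ ω, g ω * charFun ρ (Z ω - x) ∂Q = 0) : weightedCharFun Q g Z = 0 := by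
  set φ := weightedCharFun Q g Z
  have hφ : Continuous φ := continuous_weightedCharFun hg hZ
  have hφLp : MemLp φ 2 ρ := .of_bound hφ.aestronglyMeasurable (∫ ω, ‖g ω‖ ∂Q)
    (.of_forall fun a => (norm_integral_le_integral_norm _).trans_eq (by
      simp only [norm_mul, Complex.norm_exp_ofReal_mul_I, mul_one]))
  have hconj (x : E) : weightedCharFun ρ (fun a => conj (φ a)) id x = 0 := by
    have hx := congrArg conj ((integral_mul_charFun_sub hg hZ x).symm.trans (h0 x))
    simpa only [weightedCharFun, id_eq, φ, ← integral_conj, map_mul, ← Complex.exp_conj, map_neg,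
      Complex.conj_ofReal, Complex.conj_I, neg_mul_neg, map_zero, mul_comm (Complex.exp _)] using hx
  have hsq : ∫ a, ‖φ a‖ ^ 2 ∂ρ = 0 := by
    have hswap := integral_mul_weightedCharFun hg
      (Complex.conjLIE.integrable_comp_iff.2 (hφLp.integrable one_le_two)) hZ
    simp only [Complex.conjLIE_apply, hconj, mul_zero, integral_zero] at hswap
    simp only [φ, Complex.conj_mul'] at hswap
    exact_mod_cast hswap.symm
  have hae : φ =ᵐ[ρ] 0 := by
    have hzero := (integral_eq_zero_iff_of_nonneg (fun a => by positivity)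
      (hφLp.integrable_norm_pow two_ne_zero)).1 hsq
    filter_upwards [hzero] with a ha
    simpa using ha
  exact (hφ.ae_eq_iff_eq ρ continuous_zero).1 hae

theorem charFun_mapPosPart {g : Ω → ℝ} (hg : AEMeasurable g Q) (hZ : Measurable Z) (a : E) :
    charFun (mapPosPart Q g Z) a = weightedCharFun Q (fun ω => ((max (g ω) 0 : ℝ) : ℂ)) Z a := by
  rw [charFun_apply, mapPosPart, integral_map hZ.aemeasurable (by fun_prop),
    integral_withDensity_eq_integral_toReal_smul₀ hg.ennreal_ofReal (by simp)]
  simp only [ENNReal.toReal_ofReal', Complex.real_smul, weightedCharFun]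

theorem mapPosPart_eq_mapPosPart_neg [CompleteSpace E] {g : Ω → ℝ} (hg : Integrable g Q)
    (hZ : Measurable Z) (h0 : weightedCharFun Q (fun ω => (g ω : ℂ)) Z = 0) :
    mapPosPart Q g Z = mapPosPart Q (-g) Z := by
  have := isFiniteMeasure_mapPosPart (Z := Z) hg
  have := isFiniteMeasure_mapPosPart (Z := Z) hg.neg
  refine Measure.ext_of_charFun (funext fun a => ?_)
  rw [charFun_mapPosPart hg.aemeasurable hZ, charFun_mapPosPart hg.neg.aemeasurable hZ,
    ← sub_eq_zero]
  refine Eq.trans ?_ (congrFun h0 a)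
  simp only [weightedCharFun, Pi.neg_apply]
  rw [← integral_sub (integrable_ofReal_mul_cexp_ofReal_mul_I hg.pos_part (by fun_prop))
    (integrable_ofReal_mul_cexp_ofReal_mul_I hg.neg_part (by fun_prop))]
  simp only [← sub_mul, ← Complex.ofReal_sub, max_zero_sub_eq_self]

theorem setIntegral_preimage_eq_zero [CompleteSpace E] {g : Ω → ℝ} (hg : Integrable g Q)
    (hZ : Measurable Z) (h0 : weightedCharFun Q (fun ω => (g ω : ℂ)) Z = 0) {s : Set E}
    (hs : MeasurableSet s) : ∫ ω in Z ⁻¹' s, g ω ∂Q = 0 := by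
  have heq := congrArg (· s) (mapPosPart_eq_mapPosPart_neg hg hZ h0)
  simp only [mapPosPart, Measure.map_apply hZ hs, withDensity_apply _ (hZ hs), Pi.neg_apply] at heq
  rw [integral_eq_lintegral_pos_part_sub_lintegral_neg_part hg.integrableOn, heq, sub_self]

theorem condExp_comap_eq_zero [CompleteSpace E] [IsFiniteMeasure Q] {g : Ω → ℝ}
    (hg : Integrable g Q) (hZ : Measurable Z)
    (h0 : weightedCharFun Q (fun ω => (g ω : ℂ)) Z = 0) :
    Q[g | MeasurableSpace.comap Z inferInstance] =ᵐ[Q] 0 := by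
  refine (ae_eq_condExp_of_forall_setIntegral_eq hZ.comap_le hg (fun _ _ _ => integrableOn_zero)
    ?_ aestronglyMeasurable_zero).symm
  rintro _ ⟨s, hs, rfl⟩ -
  simp only [integral_zero, setIntegral_preimage_eq_zero hg hZ h0 hs]

end WeightedCharFun

section CauchyMeasure

theorem integrable_exp_neg_mul_abs {c : ℝ} (hc : 0 < c) :
    Integrable fun s : ℝ => Real.exp (-c * |s|) := by
  rw [← integrableOn_univ, ← Set.Iic_union_Ioi (a := (0 : ℝ))]
  refine .union ?_ ?_
  · refine (integrableOn_exp_mul_Iic hc 0).congr_fun (fun s hs => ?_) measurableSet_Iic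
    dsimp only
    rw [abs_of_nonpos hs, neg_mul_neg]
  · refine (integrableOn_exp_mul_Ioi (neg_neg_of_pos hc) 0).congr_fun (fun s hs => ?_)
      measurableSet_Ioi
    dsimp only
    rw [abs_of_pos hs]

theorem integral_exp_neg_mul_abs_mul_cexp {c : ℝ} (hc : 0 < c) (a : ℝ) :
    ∫ s : ℝ, (Real.exp (-c * |s|) : ℂ) * Complex.exp ((a * s : ℝ) * Complex.I) =
      (2 * c / (c ^ 2 + a ^ 2) : ℝ) := by
  have hint := integrable_ofReal_mul_cexp_ofReal_mul_I (integrable_exp_neg_mul_abs hc)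
    (φ := fun s => a * s) (by fun_prop)
  have hneg : ∫ s in Set.Iic (0 : ℝ), (Real.exp (-c * |s|) : ℂ) *
      Complex.exp ((a * s : ℝ) * Complex.I) =
        ∫ s in Set.Iic (0 : ℝ), Complex.exp ((c + a * Complex.I) * s) := by
    refine setIntegral_congr_fun measurableSet_Iic fun s hs => ?_
    simp only [abs_of_nonpos (Set.mem_Iic.1 hs), Complex.ofReal_exp, ← Complex.exp_add]
    push_cast
    ring_nf
  have hpos : ∫ s in Set.Ioi (0 : ℝ), (Real.exp (-c * |s|) : ℂ) *
      Complex.exp ((a * s : ℝ) * Complex.I) =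
        ∫ s in Set.Ioi (0 : ℝ), Complex.exp ((-c + a * Complex.I) * s) := by
    refine setIntegral_congr_fun measurableSet_Ioi fun s hs => ?_
    simp only [abs_of_pos (Set.mem_Ioi.1 hs), Complex.ofReal_exp, ← Complex.exp_add]
    push_cast
    ring_nf
  have hne₁ : (c + a * Complex.I : ℂ) ≠ 0 := fun h => hc.ne' (by simpa using congrArg Complex.re h)
  have hne₂ : (-c + a * Complex.I : ℂ) ≠ 0 :=
    fun h => hc.ne' (by simpa using congrArg Complex.re h)
  have hne₃ : (c ^ 2 + a ^ 2 : ℂ) ≠ 0 := by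
    exact_mod_cast (by positivity : (c ^ 2 + a ^ 2 : ℝ) ≠ 0)
  rw [← intervalIntegral.integral_Iic_add_Ioi hint.integrableOn hint.integrableOn, hneg, hpos,
    integral_exp_mul_complex_Iic (by simpa using hc),
    integral_exp_mul_complex_Ioi (by simpa using hc)]
  simp only [Complex.ofReal_zero, mul_zero, Complex.exp_zero]
  push_cast
  field_simp
  linear_combination (-2 * c * a ^ 2 : ℂ) * Complex.I_sq

theorem fourier_exp_neg_mul_abs {γ : ℝ≥0} (hγ : γ ≠ 0) (x : ℝ) :
    FourierTransform.fourier (fun s : ℝ => (Real.exp (-(2 * Real.pi * γ) * |s|) : ℂ)) x =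
      cauchyPDFReal 0 γ x := by
  have hint := integral_exp_neg_mul_abs_mul_cexp (c := 2 * Real.pi * γ) (by positivity)
    (-(2 * Real.pi * x))
  have hden : (γ : ℝ) ^ 2 + x ^ 2 ≠ 0 := by positivity
  rw [Real.fourier_real_eq_integral_exp_smul, cauchyPDFReal_def]
  refine Eq.trans (integral_congr_ae (.of_forall fun s => ?_)) (hint.trans ?_)
  · dsimp only
    rw [smul_eq_mul, mul_comm]
    ring_nf
  · congr 1
    field_simp
    ring

theorem charFun_cauchyMeasure {γ : ℝ≥0} (hγ : γ ≠ 0) (s : ℝ) :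
    charFun (cauchyMeasure 0 γ) s = Real.exp (-γ * |s|) := by
  have hfourier := funext (fourier_exp_neg_mul_abs hγ)
  have hinv := Continuous.fourierInv_fourier_eq
    (f := fun s : ℝ => (Real.exp (-(2 * Real.pi * γ) * |s|) : ℂ)) (by fun_prop)
    (integrable_exp_neg_mul_abs (by positivity)).ofReal
    (hfourier ▸ (integrable_cauchyPDFReal 0).ofReal)
  have hs := congrFun hinv (s / (2 * Real.pi))
  rw [hfourier, Real.fourierInv_eq'] at hs
  rw [charFun_apply_real, cauchyMeasure_of_scale_ne_zero 0 hγ,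
    integral_withDensity_eq_integral_toReal_smul (by fun_prop) (by simp [cauchyPDF_def])]
  refine Eq.trans (integral_congr_ae (.of_forall fun x => ?_)) (hs.trans ?_)
  · simp only [cauchyPDF_def, ENNReal.toReal_ofReal (cauchyPDF_pos 0 hγ x).le, Complex.real_smul,
      smul_eq_mul]
    rw [mul_comm]
    congr 3
    simp only [RCLike.inner_apply, conj_trivial]
    push_cast
    field_simp
  · rw [abs_div, abs_of_pos Real.two_pi_pos]
    congr 2
    field_simp

theorem isOpenPosMeasure_cauchyMeasure (x₀ : ℝ) {γ : ℝ≥0} (hγ : γ ≠ 0) :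
    (cauchyMeasure x₀ γ).IsOpenPosMeasure := by
  rw [cauchyMeasure_of_scale_ne_zero x₀ hγ]
  refine (withDensity_absolutelyContinuous' (by fun_prop) (.of_forall fun x => ?_)).isOpenPosMeasure
  simpa [cauchyPDF_def] using cauchyPDF_pos x₀ hγ x

end CauchyMeasure

section SpectralMeasure

theorem exists_charFun_eq_exp_neg_abs_pow {q : ℕ} (hq : q = 1 ∨ q = 2) :
    ∃ ν : Measure ℝ, IsProbabilityMeasure ν ∧ ν.IsOpenPosMeasure ∧
      ∀ s, charFun ν s = Real.exp (-|s| ^ q) := by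
  rcases hq with rfl | rfl
  · refine ⟨cauchyMeasure 0 1, inferInstance, isOpenPosMeasure_cauchyMeasure 0 one_ne_zero,
      fun s => ?_⟩
    rw [charFun_cauchyMeasure one_ne_zero, NNReal.coe_one, neg_one_mul, pow_one]
  · refine ⟨gaussianReal 0 2, inferInstance,
      (gaussianReal_absolutelyContinuous' 0 two_ne_zero).isOpenPosMeasure, fun s => ?_⟩
    rw [charFun_gaussianReal, sq_abs]
    push_cast
    ring_nf

theorem exists_charFun_eq_exp_neg_sum_abs_pow (ι : Type*) [Fintype ι] {q : ℕ}
    (hq : q = 1 ∨ q = 2) :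
    ∃ ν : Measure (EuclideanSpace ℝ ι), IsProbabilityMeasure ν ∧ ν.IsOpenPosMeasure ∧
      ∀ x, charFun ν x = Real.exp (-∑ i, |x i| ^ q) := by
  obtain ⟨ν, _, _, hν⟩ := exists_charFun_eq_exp_neg_abs_pow hq
  refine ⟨(Measure.pi fun _ : ι => ν).map (WithLp.toLp 2),
    Measure.isProbabilityMeasure_map (by fun_prop),
    (PiLp.continuous_toLp 2 _).isOpenPosMeasure_map (WithLp.toLp_surjective 2), fun x => ?_⟩
  rw [charFun_pi]
  simp only [hν, ← Complex.ofReal_prod, ← Real.exp_sum, Finset.sum_neg_distrib]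

variable {E : Type*} [NormedAddCommGroup E] [MeasurableSpace E] [BorelSpace E]
  [SecondCountableTopology E]

/-- The law of `t • u` for independent `t ∼ τ` and `u ∼ ν`. -/
def scaleMixture [NormedSpace ℝ E] (τ : Measure ℝ) (ν : Measure E) : Measure E :=
  (τ.prod ν).map fun x => x.1 • x.2

theorem charFun_scaleMixture [InnerProductSpace ℝ E] (τ : Measure ℝ) [IsFiniteMeasure τ]
    (ν : Measure E) [IsFiniteMeasure ν] (a : E) :
    charFun (scaleMixture τ ν) a = ∫ t, charFun ν (t • a) ∂τ := by
  have hint := integrable_mul_cexp_ofReal_mul_I (Q := τ.prod ν) (integrable_const 1)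
    (φ := fun x => ⟪x.1 • x.2, a⟫_ℝ) (by fun_prop)
  simp only [one_mul] at hint
  rw [scaleMixture, charFun_apply, integral_map (by fun_prop) (by fun_prop), integral_prod _ hint]
  simp only [charFun_apply, real_inner_smul_left, real_inner_smul_right]

theorem isOpenPosMeasure_scaleMixture [NormedSpace ℝ E] {τ : Measure ℝ} (hτ : τ {0}ᶜ ≠ 0)
    (ν : Measure E) [SFinite ν] [ν.IsOpenPosMeasure] : (scaleMixture τ ν).IsOpenPosMeasure := by
  refine ⟨fun U hU ⟨u, hu⟩ h0 => hτ ?_⟩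
  rw [scaleMixture, Measure.map_apply (by fun_prop) hU.measurableSet] at h0
  refine measure_mono_null (fun t ht => ?_)
    (Measure.measure_ae_null_of_prod_null h0)
  have hopen : IsOpen ((t • ·) ⁻¹' U : Set E) := hU.preimage (continuous_const_smul t)
  exact hopen.measure_ne_zero ν ⟨t⁻¹ • u, by simpa [smul_inv_smul₀ ht] using hu⟩

theorem exists_charFun_eq_profile (ι : Type*) [Fintype ι] {q : ℕ} (hq : q = 1 ∨ q = 2)
    {μ : Measure ℝ≥0} [IsFiniteMeasure μ] (hμ : 0 < μ (Set.Ioi 0)) :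
    ∃ ρ : Measure (EuclideanSpace ℝ ι), IsFiniteMeasure ρ ∧ ρ.IsOpenPosMeasure ∧
      ∀ x, charFun ρ x = profile μ (∑ i, |x i| ^ q) := by
  obtain ⟨ν, _, _, hν⟩ := exists_charFun_eq_exp_neg_sum_abs_pow ι hq
  have hq0 : q ≠ 0 := by lia
  let τ : Measure ℝ := μ.map fun t : ℝ≥0 => (t : ℝ) ^ (q : ℝ)⁻¹
  have : IsFiniteMeasure τ := inferInstanceAs (IsFiniteMeasure (Measure.map _ _))
  have hτ : τ {0}ᶜ ≠ 0 := by
    rw [Measure.map_apply (by fun_prop) (measurableSet_singleton 0).compl]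
    refine (hμ.trans_le (measure_mono fun t ht => ?_)).ne'
    exact (Real.rpow_pos_of_pos (NNReal.coe_pos.2 ht) _).ne'
  refine ⟨scaleMixture τ ν, inferInstanceAs (IsFiniteMeasure (Measure.map _ _)),
    isOpenPosMeasure_scaleMixture hτ ν, fun x => ?_⟩
  rw [charFun_scaleMixture, integral_map (by fun_prop) (by fun_prop), profile,
    ← integral_complex_ofReal]
  refine integral_congr_ae (.of_forall fun t => ?_)
  simp only [hν, PiLp.smul_apply, smul_eq_mul, abs_mul, mul_pow, ← Finset.mul_sum, neg_mul,
    abs_of_nonneg (Real.rpow_nonneg t.coe_nonneg _), Real.rpow_inv_natCast_pow t.coe_nonneg hq0]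

end SpectralMeasure

section ConditionalVariance

variable {Ω : Type*} {m m₀ : MeasurableSpace Ω} {Q : Measure Ω}

theorem norm_toLp_sub_toLp_sq {f g : Ω → ℝ} (hf : MemLp f 2 Q) (hg : MemLp g 2 Q) :
    ‖hf.toLp - hg.toLp‖ ^ 2 = ∫ ω, (f ω - g ω) ^ 2 ∂Q := by
  rw [← MemLp.toLp_sub, ← real_inner_self_eq_norm_sq, L2.inner_def]
  refine integral_congr_ae ?_
  filter_upwards [(hf.sub hg).coeFn_toLp] with ω hω
  simp [hω, sq]

theorem norm_toLp_sub_starProjection_lpMeas_sq [IsFiniteMeasure Q] [Fact (m ≤ m₀)] {Y : Ω → ℝ}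
    (hY : MemLp Y 2 Q) :
    ‖hY.toLp - (lpMeas ℝ ℝ m 2 Q).starProjection hY.toLp‖ ^ 2 = ∫ ω, condVar m Y Q ω ∂Q := by
  have hm : m ≤ m₀ := Fact.out
  have hproj : (lpMeas ℝ ℝ m 2 Q).starProjection hY.toLp = (hY.condExp one_le_two).toLp :=
    Lp.ext ((hY.condExpL2_ae_eq_condExp hm).trans (MemLp.coeFn_toLp _).symm)
  rw [hproj, norm_toLp_sub_toLp_sq]
  exact (integral_condExp hm).symm

end ConditionalVariance

section Density

variable {X Ω : Type*} [MeasurableSpace X] [MeasurableSpace Ω] {H : Type*} [NormedAddCommGroup H]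
  [InnerProductSpace ℝ H] [CompleteSpace H] [RKHS ℝ H X ℝ] {Z : Ω → X} {Q : Measure Ω}
  [IsFiniteMeasure Q]

namespace BoundedMeasurableKernel

theorem compLp_mem_lpMeas (hk : BoundedMeasurableKernel X H) (hZ : Measurable Z) (f : H) :
    hk.compLp Q hZ f ∈ lpMeas ℝ ℝ (MeasurableSpace.comap Z inferInstance) 2 Q := by
  rw [mem_lpMeas_iff_aestronglyMeasurable]
  exact ⟨f ∘ Z, ((hk.measurable_coe f).comp (comap_measurable Z)).stronglyMeasurable,
    (hk.memLp_comp Q hZ f).coeFn_toLp⟩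

theorem inner_compLp (hk : BoundedMeasurableKernel X H) (hZ : Measurable Z) (f : H)
    (g : Lp ℝ 2 Q) : ⟪hk.compLp Q hZ f, g⟫_ℝ = ∫ ω, g ω * f (Z ω) ∂Q := by
  rw [L2.inner_def]
  refine integral_congr_ae ?_
  filter_upwards [(hk.memLp_comp Q hZ f).coeFn_toLp] with ω hω
  rw [compLp_apply, hω]
  rfl

theorem topologicalClosure_range_compLp (hk : BoundedMeasurableKernel X H)
    (hZ : Measurable Z)
    (hker : ∀ g : Ω → ℝ, MemLp g 2 Q → (∀ x, ∫ ω, g ω * RKHS.kerFun H x (1 : ℝ) (Z ω) ∂Q = 0) →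
      Q[g | MeasurableSpace.comap Z inferInstance] =ᵐ[Q] 0) :
    (hk.compLp Q hZ : H →ₗ[ℝ] Lp ℝ 2 Q).range.topologicalClosure =
      lpMeas ℝ ℝ (MeasurableSpace.comap Z inferInstance) 2 Q := by
  set K := (hk.compLp Q hZ : H →ₗ[ℝ] Lp ℝ 2 Q).range.topologicalClosure
  set L := lpMeas ℝ ℝ (MeasurableSpace.comap Z inferInstance) 2 Q
  have hKL : K ≤ L := by
    refine Submodule.topologicalClosure_minimal _ ?_ (isClosed_aestronglyMeasurable hZ.comap_le)
    rintro _ ⟨f, rfl⟩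
    exact hk.compLp_mem_lpMeas hZ f
  have hbot : Kᗮ ⊓ L = ⊥ := by
    refine (Submodule.eq_bot_iff _).2 fun g ⟨hgK, hgL⟩ => ?_
    have horth (x : X) : ∫ ω, g ω * RKHS.kerFun H x (1 : ℝ) (Z ω) ∂Q = 0 := by
      rw [← hk.inner_compLp hZ]
      exact hgK _ (Submodule.le_topologicalClosure _ ⟨_, rfl⟩)
    have hcond := condExp_of_aestronglyMeasurable' hZ.comap_le
      (mem_lpMeas_iff_aestronglyMeasurable.1 hgL) ((Lp.memLp g).integrable one_le_two)
    exact (Lp.eq_zero_iff_ae_eq_zero).2 (hcond.symm.trans (hker g (Lp.memLp g) horth))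
  rw [← Submodule.sup_orthogonal_inf_of_hasOrthogonalProjection hKL, hbot, sup_bot_eq]

theorem tendsto_iInf_tikhonov_compLp (hk : BoundedMeasurableKernel X H)
    (hZ : Measurable Z)
    (hker : ∀ g : Ω → ℝ, MemLp g 2 Q → (∀ x, ∫ ω, g ω * RKHS.kerFun H x (1 : ℝ) (Z ω) ∂Q = 0) →
      Q[g | MeasurableSpace.comap Z inferInstance] =ᵐ[Q] 0) {Y : Ω → ℝ} (hY : MemLp Y 2 Q) :
    Tendsto (fun lam => ⨅ f, tikhonov (hk.compLp Q hZ) hY.toLp lam f) (𝓝[>] 0)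
      (𝓝 (1 / 2 * ∫ ω, condVar (MeasurableSpace.comap Z inferInstance) Y Q ω ∂Q)) := by
  have : Fact (MeasurableSpace.comap Z inferInstance ≤ ‹MeasurableSpace Ω›) := ⟨hZ.comap_le⟩
  rw [← norm_toLp_sub_starProjection_lpMeas_sq hY]
  simpa only [hk.topologicalClosure_range_compLp hZ hker] using
    tendsto_iInf_tikhonov (hk.compLp Q hZ) hY.toLp

theorem tikhonov_compLp (hk : BoundedMeasurableKernel X H) (hZ : Measurable Z) {Y : Ω → ℝ}
    (hY : MemLp Y 2 Q) (lam : ℝ) (f : H) :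
    tikhonov (hk.compLp Q hZ) hY.toLp lam f =
      1 / 2 * ∫ ω, (Y ω - f (Z ω)) ^ 2 ∂Q + lam / 2 * ‖f‖ ^ 2 := by
  rw [tikhonov, compLp_apply, norm_toLp_sub_toLp_sq]
  rfl

end BoundedMeasurableKernel

end Density

section LqKernel

variable {μ : Measure ℝ≥0} {q : ℕ}

theorem measurable_profile [IsFiniteMeasure μ] : Measurable (profile μ) := by
  have hexp : StronglyMeasurable fun x : ℝ × ℝ≥0 => Real.exp (-(x.2 : ℝ) * x.1) :=
    Measurable.stronglyMeasurable (by fun_prop)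
  exact hexp.integral_prod_right.measurable

theorem condExp_comap_eq_zero_of_integral_mul_profile [IsFiniteMeasure μ]
    (hμ : 0 < μ (Set.Ioi 0)) (hq : q = 1 ∨ q = 2) {ι Ω : Type*} [Fintype ι] [MeasurableSpace Ω]
    {Q : Measure Ω} [IsFiniteMeasure Q] {g : Ω → ℝ} (hg : Integrable g Q) {Z : Ω → ι → ℝ}
    (hZ : Measurable Z) (h0 : ∀ x : ι → ℝ, ∫ ω, g ω * profile μ (∑ i, |Z ω i - x i| ^ q) ∂Q = 0) :
    Q[g | MeasurableSpace.comap Z inferInstance] =ᵐ[Q] 0 := by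
  obtain ⟨ρ, _, _, hρ⟩ := exists_charFun_eq_profile ι hq hμ
  let e : (ι → ℝ) ≃ᵐ EuclideanSpace ℝ ι := MeasurableEquiv.toLp 2 (ι → ℝ)
  have heZ : Measurable (e ∘ Z) := e.measurable.comp hZ
  have hcomap : MeasurableSpace.comap Z inferInstance =
      MeasurableSpace.comap (e ∘ Z) inferInstance := by
    rw [← MeasurableSpace.comap_comp, e.measurableEmbedding.comap_eq]
  rw [hcomap]
  refine condExp_comap_eq_zero hg heZ
    (weightedCharFun_eq_zero_of_integral_mul_charFun_sub hg.ofReal heZ (ρ := ρ) fun x => ?_)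
  have hρZ (ω : Ω) : charFun ρ ((e ∘ Z) ω - x) = profile μ (∑ i, |Z ω i - x i| ^ q) := hρ _
  have hx := congrArg Complex.ofReal (h0 x)
  rw [← integral_complex_ofReal] at hx
  simpa only [hρZ, Complex.ofReal_mul, Complex.ofReal_zero] using hx

variable {p : ℕ} {H : Type*} [NormedAddCommGroup H] [InnerProductSpace ℝ H] [CompleteSpace H]
  [RKHS ℝ H (Fin p → ℝ) ℝ]

theorem kerFun_apply_eq_profile (hH : RKHS.kernel H = lqKernel μ q p) (x x' : Fin p → ℝ) (v : ℝ) :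
    RKHS.kerFun H x v x' = profile μ (∑ i, |x' i - x i| ^ q) * v := by
  simp only [RKHS.kerFun_apply, hH, lqKernel, Matrix.of_apply, smul_apply,
    ContinuousLinearMap.id_apply, smul_eq_mul]

theorem boundedMeasurableKernel_of_kernel_eq_lqKernel [IsFiniteMeasure μ] (hq : q ≠ 0)
    (hH : RKHS.kernel H = lqKernel μ q p) : BoundedMeasurableKernel (Fin p → ℝ) H where
  measurable_kerFun x v := by
    change Measurable fun x' => RKHS.kerFun H x v x'
    simp only [kerFun_apply_eq_profile hH]
    exact (measurable_profile.comp (by fun_prop)).mul_const _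
  bddAbove_kernel := ⟨|profile μ 0|, Set.forall_mem_range.2 fun x => by
    simp [hH, lqKernel, hq, norm_smul]⟩

theorem condExp_comap_eq_zero_of_integral_mul_kerFun [IsFiniteMeasure μ]
    (hμ : 0 < μ (Set.Ioi 0)) (hq : q = 1 ∨ q = 2) (hH : RKHS.kernel H = lqKernel μ q p)
    {Ω : Type*} [MeasurableSpace Ω] {Q : Measure Ω} [IsFiniteMeasure Q] {g : Ω → ℝ}
    (hg : Integrable g Q) {Z : Ω → Fin p → ℝ} (hZ : Measurable Z)
    (h0 : ∀ x, ∫ ω, g ω * RKHS.kerFun H x (1 : ℝ) (Z ω) ∂Q = 0) :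
    Q[g | MeasurableSpace.comap Z inferInstance] =ᵐ[Q] 0 :=
  condExp_comap_eq_zero_of_integral_mul_profile hμ hq hg hZ fun x => by
    simpa only [kerFun_apply_eq_profile hH, mul_one] using h0 x

end LqKernel

section Rescale

theorem measurable_rescale (q : ℕ) {p : ℕ} (β : Fin p → ℝ) : Measurable (rescale q β) := by
  unfold rescale
  fun_prop

theorem comap_mul_eq_comap_restrict_support {ι Ω : Type*} (c : ι → ℝ) (X : Ω → ι → ℝ) :
    MeasurableSpace.comap (fun ω i => c i * X ω i) inferInstance =
      MeasurableSpace.comap (fun ω (i : Function.support c) => X ω i) inferInstance := by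
  refine le_antisymm (Measurable.comap_le ?_) (Measurable.comap_le ?_)
  · let _ := MeasurableSpace.comap (fun ω (i : Function.support c) => X ω i) inferInstance
    refine measurable_pi_lambda _ fun i => ?_
    by_cases hi : c i = 0
    · simp only [hi, zero_mul, measurable_const]
    · exact ((measurable_pi_apply (⟨i, hi⟩ : Function.support c)).comp
        (comap_measurable fun ω (i : Function.support c) => X ω i)).const_mul (c i)
  · let _ := MeasurableSpace.comap (fun ω i => c i * X ω i) inferInstance
    refine measurable_pi_lambda _ fun i => ?_
    have hcoord := ((measurable_pi_apply (i : ι)).comp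
      (comap_measurable fun ω i => c i * X ω i)).const_mul (c i)⁻¹
    simpa only [Function.comp_def, inv_mul_cancel_left₀ i.2] using hcoord

theorem support_rpow_of_nonneg {ι : Type*} {β : ι → ℝ} (hβ : ∀ i, 0 ≤ β i) {r : ℝ} (hr : r ≠ 0) :
    Function.support (fun i => β i ^ r) = Function.support β := by
  ext i
  simp only [Function.mem_support, ne_eq, Real.rpow_eq_zero (hβ i) hr]

theorem sigmaX_support_eq_comap_rescale {q : ℕ} (hq : q ≠ 0) {p : ℕ} {β : Fin p → ℝ}
    (hβ : ∀ i, 0 ≤ β i) :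
    sigmaX (Function.support β) =
      MeasurableSpace.comap (fun z : (Fin p → ℝ) × ℝ => rescale q β z.1) inferInstance := by
  rw [← support_rpow_of_nonneg hβ (one_div_ne_zero (Nat.cast_ne_zero.2 hq))]
  exact (comap_mul_eq_comap_restrict_support _ _).symm

end Rescale

end KernelFeature

end

theorem mainTheorem8_general {p : ℕ} (q : ℕ) (hq : q = 1 ∨ q = 2)
    (μ : Measure ℝ≥0) [IsFiniteMeasure μ] (hμ : 0 < μ (Set.Ioi 0))
    (H : Type*) [NormedAddCommGroup H] [InnerProductSpace ℝ H] [CompleteSpace H]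
    [RKHS ℝ H (Fin p → ℝ) ℝ] (hH : RKHS.kernel H = KernelFeature.lqKernel μ q p)
    (Q : Measure ((Fin p → ℝ) × ℝ)) [IsFiniteMeasure Q]
    (hY : MemLp (fun z : (Fin p → ℝ) × ℝ => z.2) 2 Q)
    (β : Fin p → ℝ) (hβ : ∀ i, 0 ≤ β i) :
    (∀ lam : ℝ, 0 < lam →
      IsLeast (Set.range (KernelFeature.krrFunctional H q Q β lam))
        (KernelFeature.krrObjective H q Q β lam)) ∧
    Tendsto (fun lam : ℝ => KernelFeature.krrObjective H q Q β lam) (𝓝[>] 0)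
      (𝓝 (1 / 2 * ∫ z, condVar (KernelFeature.sigmaX (Function.support β))
        (fun z : (Fin p → ℝ) × ℝ => z.2) Q z ∂Q)) := by
  have hq0 : q ≠ 0 := by lia
  have hk := KernelFeature.boundedMeasurableKernel_of_kernel_eq_lqKernel hq0 hH
  have hZ : Measurable fun z : (Fin p → ℝ) × ℝ => KernelFeature.rescale q β z.1 :=
    (KernelFeature.measurable_rescale q β).comp measurable_fst
  have hkrr (lam : ℝ) : KernelFeature.krrFunctional H q Q β lam =
      KernelFeature.tikhonov (hk.compLp Q hZ) hY.toLp lam :=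
    funext fun f => (hk.tikhonov_compLp hZ hY lam f).symm
  simp only [KernelFeature.krrObjective, hkrr,
    KernelFeature.sigmaX_support_eq_comap_rescale hq0 hβ]
  refine ⟨fun lam hlam => KernelFeature.isLeast_iInf_tikhonov _ _ hlam, ?_⟩
  exact hk.tendsto_iInf_tikhonov_compLp hZ (fun g hg =>
    KernelFeature.condExp_comap_eq_zero_of_integral_mul_kerFun hμ hq hH
      (hg.integrable one_le_two) hZ) hY

theorem mainTheorem8 {p : ℕ} (q : ℕ) (hq : q = 1 ∨ q = 2)
    (μ : Measure ℝ≥0) [IsFiniteMeasure μ] (hμ : KernelFeature.SupportRegular μ)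
    (H : Type*) [NormedAddCommGroup H] [InnerProductSpace ℝ H] [CompleteSpace H]
    [RKHS ℝ H (Fin p → ℝ) ℝ] (hH : RKHS.kernel H = KernelFeature.lqKernel μ q p)
    (Q : Measure ((Fin p → ℝ) × ℝ)) [IsProbabilityMeasure Q]
    (hY : MemLp (fun z : (Fin p → ℝ) × ℝ => z.2) 2 Q)
    (β : Fin p → ℝ) (hβ : ∀ i, 0 ≤ β i) :
    (∀ lam : ℝ, 0 < lam →
      IsLeast (Set.range (KernelFeature.krrFunctional H q Q β lam))
        (KernelFeature.krrObjective H q Q β lam)) ∧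
    Tendsto (fun lam : ℝ => KernelFeature.krrObjective H q Q β lam) (𝓝[>] 0)
      (𝓝 (1 / 2 * ∫ z, condVar (KernelFeature.sigmaX (Function.support β))
        (fun z : (Fin p → ℝ) × ℝ => z.2) Q z ∂Q)) :=
  mainTheorem8_general q hq μ hμ.pos_mass H hH Q hY β hβ
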